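/- Let $D\ge 2$ and $n\ge 2$, and let $P=(p_1,\dots,p_n)$ be a probability mass function with all $p_i>0$. Let $T$ be a finite $D$-ary tree, i.e. a finite subtree of the infinite rooted tree in which each node has $D$ children, and let $T$ be associated with $P$, i.e. let a one-to-one correspondence between the leaves of $T$ and $p_1,\dots,p_n$ (counted with their indices) be given. The probability of a leaf is the corresponding $p_i$, and the probability of an internal node is the sum of the probabilities of its children. The level of a node is its distance from the root. A sibling set is the set of the children of an internal node. Let $m$ be the integer with $2\le m\le D$ such that $D-1$ divides $n-m$. The Huffman algorithm on $P$ starts with the forest of $n$ isolated vertices with probabilities $p_1,\dots,p_n$. In its first step it chooses some $m$ vertices with the lowest $m$ probabilities, and in every later step some $D$ roots with the lowest $D$ probabilities among the roots of the current forest (ties are broken arbitrarily); it makes a new vertex, whose probability is the sum of the chosen probabilities, the parent of the chosen ones. It stops when the forest is a tree. $T$ is called a Huffman tree for $P$ if some run of the algorithm ends in a tree isomorphic to $T$ (as a rooted tree, respecting the association of the leaves with $p_1,\dots,p_n$). Then $T$ is a Huffman tree for $P$ if and only if the following three conditions hold. (P1) If a node $v$ has a smaller level than a node $w$, then the probability of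 $v$ is greater than or equal to that of $w$. (P2) $T$ has a sibling set at its maximum level that has exactly $m$ nodes and carries the lowest $m$ probabilities of $P$ (that is, each of its nodes is a leaf whose probability is at most that of every leaf outside the set), and every other sibling set of $T$ has exactly $D$ nodes. (P3) For each level, the nodes of $T$ at that level can be listed in such a way that their probabilities are in non-decreasing order and siblings come next to each other in the listing (each sibling set at that level occupies consecutive places). -/

import Mathlib

noncomputable section

namespace HuffmanTree

open Finset

/-- A (finite) `D`-ary tree, i.e. a finite subtree of the infinite rooted tree `T_∞` in which every
node has `D` outgoing edges. The nodes of `T_∞` are the words over `Fin D`; the root of `T_∞` is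
`[]`, and the `D` children of the word `v` are the words `a :: v` (so a word lists the edge labels
from the node up to the root). A subtree is a nonempty connected set of nodes: it has a top node
`root` above all its nodes, and contains the parent of each of its nodes other than `root`. -/
structure DTree (D : ℕ) where
  nodes : Finset (List (Fin D))
  root : List (Fin D)
  root_mem : root ∈ nodes
  root_suffix : ∀ v ∈ nodes, root <:+ v
  parent_mem : ∀ (a : Fin D) (v : List (Fin D)), a :: v ∈ nodes → a :: v ≠ root → v ∈ nodes

namespace DTree

variable {D : ℕ}

/-- The children in `T` of the node `v`. -/
def children (T : DTree D) (v : List (Fin D)) : Finset (List (Fin D)) :=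
  T.nodes.filter (fun w => ∃ a : Fin D, w = a :: v)

/-- The leaves: nodes without children. -/
def leaves (T : DTree D) : Finset (List (Fin D)) :=
  T.nodes.filter (fun v => T.children v = ∅)

/-- A sibling set: the set of the children of an internal node. -/
def IsSiblingSet (T : DTree D) (S : Finset (List (Fin D))) : Prop :=
  ∃ v ∈ T.nodes, v ∉ T.leaves ∧ S = T.children v

/-- Two nodes are siblings if they have the same parent in `T`. -/
def Siblings (T : DTree D) (v w : List (Fin D)) : Prop :=
  ∃ u ∈ T.nodes, v ∈ T.children u ∧ w ∈ T.children u

/-- The level of a node of `T`: the length of the path from the root of `T` to it. -/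
def level (T : DTree D) (v : List (Fin D)) : ℕ := v.length - T.root.length

/-- The maximum level of a node of `T`. -/
def maxLevel (T : DTree D) : ℕ := T.nodes.sup T.level

end DTree

/-- A tree associated with a PMF `(p_1, …, p_n)`: a `D`-ary tree together with a one-to-one
correspondence between its leaves and the `n` (indices of the) probabilities. -/
structure AssocTree (D n : ℕ) extends DTree D where
  label : {v : List (Fin D) // v ∈ toDTree.leaves} ≃ Fin n

/-- The set `𝒫_n` of PMFs `(p_1, …, p_n)` with all `p_i > 0`. -/
def PosPMF (n : ℕ) : Set (Fin n → ℝ) := {p | (∀ i, 0 < p i) ∧ ∑ i, p i = 1}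

/-- The probability of a node of `T`: a leaf has the probability of `P` that corresponds to it,
an internal node has the sum of the probabilities of its children. -/
def AssocTree.prob {D n : ℕ} (T : AssocTree D n) (p : Fin n → ℝ) (v : List (Fin D)) : ℝ :=
  if h : v ∈ T.leaves then p (T.label ⟨v, h⟩)
  else ∑ c ∈ (T.children v).attach, T.prob p c.1
termination_by T.nodes.sup List.length + 1 - v.length
decreasing_by
  obtain ⟨c, hc⟩ := c
  obtain ⟨hc, a, rfl⟩ := Finset.mem_filter.1 hc
  have := Finset.le_sup (f := List.length) hc
  simp only [List.length_cons] at this ⊢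
  omega

/-- `m` is the number of vertices merged in the first step of the `D`-ary Huffman algorithm on
`n` probabilities: `2 ≤ m ≤ D` and `D - 1` divides `n - m`. -/
def IsFirstSize (D n m : ℕ) : Prop :=
  2 ≤ m ∧ m ≤ D ∧ ((D : ℤ) - 1) ∣ ((n : ℤ) - (m : ℤ))

/-! ### The Huffman algorithm -/

/-- The data of a rooted directed forest whose vertices carry probabilities: a finite vertex set,
the parent of each vertex (if any), and the probabilities. The vertex `Sum.inl i` stands for the
`i`-th source symbol; the vertices `Sum.inr k` are at disposal as new vertices. -/
structure Forest (n : ℕ) where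
  verts : Finset (Fin n ⊕ ℕ)
  parent : Fin n ⊕ ℕ → Option (Fin n ⊕ ℕ)
  prob : Fin n ⊕ ℕ → ℝ

namespace Forest

variable {n : ℕ}

/-- The roots of the trees of the forest: the vertices without a parent. -/
def roots (F : Forest n) : Finset (Fin n ⊕ ℕ) := F.verts.filter (fun v => F.parent v = none)

/-- The forest is a tree: it has exactly one root. -/
def IsTree (F : Forest n) : Prop := F.roots.card = 1

/-- The forest `F_1`: the `n` isolated vertices, the `i`-th with probability `p i`. -/
def initial (p : Fin n → ℝ) : Forest n where
  verts := Finset.univ.map Function.Embedding.inl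
  parent := fun _ => none
  prob := Sum.elim p (fun _ => 0)

/-- Add the vertex `r` as the parent of all the vertices in `S`, with probability the sum of the
probabilities of its children. -/
def addParent (F : Forest n) (S : Finset (Fin n ⊕ ℕ)) (r : Fin n ⊕ ℕ) : Forest n where
  verts := insert r F.verts
  parent := fun v => if v ∈ S then some r else F.parent v
  prob := Function.update F.prob r (∑ s ∈ S, F.prob s)

/-- `F'` results from `F` by choosing some `k` roots with the lowest `k` probabilities (ties broken
arbitrarily) and making a new vertex their parent. -/
def Merge (k : ℕ) (F F' : Forest n) : Prop :=
  ∃ (S : Finset (Fin n ⊕ ℕ)) (r : Fin n ⊕ ℕ),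
    S ⊆ F.roots ∧ S.card = k ∧ (∀ s ∈ S, ∀ t ∈ F.roots \ S, F.prob s ≤ F.prob t) ∧
    r ∉ F.verts ∧ F' = F.addParent S r

end Forest

/-- The forests `F_2, F_3, …` that can occur in a run of the `D`-ary Huffman algorithm on `p`: the
first step merges `m` vertices of `F_1`, every later one `D` roots, until a tree is reached. -/
inductive HuffmanForest (D : ℕ) {n : ℕ} (p : Fin n → ℝ) : Forest n → Prop
  | first {m : ℕ} {F : Forest n} (hm : IsFirstSize D n m)
      (h : Forest.Merge m (Forest.initial p) F) : HuffmanForest D p F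
  | next {F F' : Forest n} (hF : HuffmanForest D p F) (hT : ¬ F.IsTree)
      (h : Forest.Merge D F F') : HuffmanForest D p F'

/-- `T` is a Huffman tree for `p`: some run of the Huffman algorithm on `p` ends in a tree that is
isomorphic to `T` as a rooted tree, the leaf of `T` with label `i` corresponding to the `i`-th of
the initial vertices. -/
def IsHuffmanTree {D n : ℕ} (T : AssocTree D n) (p : Fin n → ℝ) : Prop :=
  ∃ F : Forest n, HuffmanForest D p F ∧ F.IsTree ∧
    ∃ ψ : {v : List (Fin D) // v ∈ T.nodes} ≃ {x : Fin n ⊕ ℕ // x ∈ F.verts},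
      (∀ v w, F.parent (ψ w).1 = some (ψ v).1 ↔ w.1 ∈ T.children v.1) ∧
      (∀ v (h : v.1 ∈ T.leaves), (ψ v).1 = Sum.inl (T.label ⟨v.1, h⟩))

/-! ### The three Huffman tree properties -/

/-- Level property: a node at a lower level (nearer to the root) has a probability at least
that of a node at a higher level. -/
def LevelProperty {D n : ℕ} (T : AssocTree D n) (p : Fin n → ℝ) : Prop :=
  ∀ v ∈ T.nodes, ∀ w ∈ T.nodes, T.level v < T.level w → T.prob p w ≤ T.prob p v

/-- Maximum-level sibling property: with `m` as in the Huffman algorithm, some sibling set at the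
maximum level has `m` nodes and carries the lowest `m` probabilities of `p`, and all the other
sibling sets have exactly `D` nodes. -/
def MaxLevelSiblingProperty {D n : ℕ} (T : AssocTree D n) (p : Fin n → ℝ) : Prop :=
  ∃ m : ℕ, IsFirstSize D n m ∧
    ∃ S : Finset (List (Fin D)), T.IsSiblingSet S ∧ S.card = m ∧
      (∀ v ∈ S, T.level v = T.maxLevel) ∧
      (S ⊆ T.leaves ∧ ∀ v ∈ S, ∀ w ∈ T.leaves \ S, T.prob p v ≤ T.prob p w) ∧
      ∀ S' : Finset (List (Fin D)), T.IsSiblingSet S' → S' ≠ S → S'.card = D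

/-- Sibling property: the nodes at any level can be listed (each once) with non-decreasing
probabilities and with siblings next to each other, i.e. whatever is listed between two siblings
is a sibling of them. -/
def SiblingProperty {D n : ℕ} (T : AssocTree D n) (p : Fin n → ℝ) : Prop :=
  ∀ l : ℕ, ∃ L : List (List (Fin D)), L.Nodup ∧
    (∀ v, v ∈ L ↔ v ∈ T.nodes ∧ T.level v = l) ∧
    L.Pairwise (fun v w => T.prob p v ≤ T.prob p w) ∧
    ∀ x y z, [x, y, z].Sublist L → T.Siblings x z → T.Siblings x y

end HuffmanTree

end

namespace HuffmanTree

open Finset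

/-! ### Parents, levels and leaves in a tree -/

namespace DTree

variable {D : ℕ} (T : DTree D)

/-! Necessity. In a run of the algorithm the merged probabilities never decrease from step to step:
each step takes lowest roots, and a new root is at least as probable as its children. So the order
of creation numbers the internal nodes by some `τ` such that children of earlier nodes are at most
children of later ones (`MergeOrder`, obtained in `exists_mergeOrder`). Only this numbering is
needed for the three properties. (P1) goes by induction on levels, comparing sums over sibling sets;
(P2) holds for the set merged first, or for one tied with it; (P3) comes from sorting a level by the
number of the parent, then by probability.

Sufficiency. A run is built that recreates `T`: it merges the set of (P2) first, then repeatedly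
creates a missing internal node of largest level, choosing the one whose children come first in the
list of (P3). The children of that node are already roots. They are lowest among the roots because
(P1) handles roots at smaller levels, (P3) handles those at the same level, and by maximality there
are none deeper (`exists_next`). -/

theorem mem_children {v w : List (Fin D)} :
    w ∈ T.children v ↔ w ∈ T.nodes ∧ ∃ a : Fin D, w = a :: v := by
  simp [children]

/-- An internal node: a node that has a child. -/
def Internal (u : List (Fin D)) : Prop := u ∈ T.nodes ∧ (T.children u).Nonempty

theorem mem_leaves {v : List (Fin D)} : v ∈ T.leaves ↔ v ∈ T.nodes ∧ T.children v = ∅ := by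
  simp [leaves]

theorem internal_iff {u : List (Fin D)} : T.Internal u ↔ u ∈ T.nodes ∧ u ∉ T.leaves := by
  rw [mem_leaves, Internal, nonempty_iff_ne_empty]
  tauto

theorem mem_leaves_or_internal {v : List (Fin D)} (hv : v ∈ T.nodes) :
    v ∈ T.leaves ∨ T.Internal v := by
  rw [internal_iff]; tauto

theorem isSiblingSet_iff {S : Finset (List (Fin D))} :
    T.IsSiblingSet S ↔ ∃ u, T.Internal u ∧ S = T.children u := by
  simp only [IsSiblingSet, internal_iff, and_assoc]

variable {T}

theorem mem_nodes_of_mem_children {v w : List (Fin D)} (h : w ∈ T.children v) : w ∈ T.nodes :=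
  (T.mem_children.1 h).1

theorem internal_of_mem_children {v w : List (Fin D)} (hv : v ∈ T.nodes) (h : w ∈ T.children v) :
    T.Internal v := ⟨hv, w, h⟩

theorem parent_unique {u v w : List (Fin D)} (h : w ∈ T.children u) (h' : w ∈ T.children v) :
    u = v := by
  obtain ⟨-, a, rfl⟩ := T.mem_children.1 h
  obtain ⟨-, b, hb⟩ := T.mem_children.1 h'
  exact (List.cons.inj hb).2

theorem exists_parent {v : List (Fin D)} (hv : v ∈ T.nodes) (h : v ≠ T.root) :
    ∃ u, T.Internal u ∧ v ∈ T.children u := by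
  cases v with
  | nil => exact absurd (List.suffix_nil.1 (T.root_suffix _ hv)).symm h
  | cons a u =>
    have hc : a :: u ∈ T.children u := T.mem_children.2 ⟨hv, a, rfl⟩
    exact ⟨u, ⟨T.parent_mem a u hv h, _, hc⟩, hc⟩

theorem level_child {u v : List (Fin D)} (hu : u ∈ T.nodes) (h : v ∈ T.children u) :
    T.level v = T.level u + 1 := by
  obtain ⟨-, a, rfl⟩ := T.mem_children.1 h
  have := (T.root_suffix u hu).length_le
  simp only [level, List.length_cons]
  omega

theorem level_root : T.level T.root = 0 := by simp [level]

theorem ne_root_of_mem_children {u v : List (Fin D)} (hu : u ∈ T.nodes) (h : v ∈ T.children u) :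
    v ≠ T.root := by
  rintro rfl
  have := level_child hu h
  rw [level_root] at this
  omega

theorem eq_root_of_level_eq_zero {v : List (Fin D)} (hv : v ∈ T.nodes) (h : T.level v = 0) :
    v = T.root := by
  by_contra hne
  obtain ⟨u, hu, huv⟩ := exists_parent hv hne
  have := level_child hu.1 huv
  omega

theorem level_le_maxLevel {v : List (Fin D)} (hv : v ∈ T.nodes) : T.level v ≤ T.maxLevel :=
  Finset.le_sup hv

theorem exists_level_eq_maxLevel : ∃ v ∈ T.nodes, T.level v = T.maxLevel := by
  obtain ⟨v, hv, h⟩ := Finset.exists_mem_eq_sup T.nodes ⟨_, T.root_mem⟩ T.level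
  exact ⟨v, hv, h.symm⟩

theorem mem_leaves_of_level_eq_maxLevel {v : List (Fin D)} (hv : v ∈ T.nodes)
    (h : T.level v = T.maxLevel) : v ∈ T.leaves := by
  refine T.mem_leaves.2 ⟨hv, Finset.eq_empty_of_forall_notMem fun w hw => ?_⟩
  have h1 := level_child hv hw
  have h2 := level_le_maxLevel (mem_nodes_of_mem_children hw)
  omega

/-- Induction from the leaves to the root. -/
theorem children_induction {P : List (Fin D) → Prop}
    (h : ∀ v ∈ T.nodes, (∀ w ∈ T.children v, P w) → P v) : ∀ v ∈ T.nodes, P v := by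
  have key : ∀ k v, v ∈ T.nodes → T.maxLevel - T.level v = k → P v := by
    intro k
    induction k using Nat.strong_induction_on with
    | _ k ih =>
      intro v hv hk
      refine h v hv fun w hw => ?_
      have h1 := level_child hv hw
      have hw' := mem_nodes_of_mem_children hw
      have h2 := level_le_maxLevel hw'
      exact ih _ (by omega) w hw' rfl
  exact fun v hv => key _ v hv rfl

end DTree

/-! ### Probabilities of nodes -/

namespace AssocTree

open DTree

variable {D n : ℕ} (T : AssocTree D n) {p : Fin n → ℝ}

theorem prob_of_mem_leaves {v : List (Fin D)} (h : v ∈ T.leaves) :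
    T.prob p v = p (T.label ⟨v, h⟩) := by
  rw [AssocTree.prob, dif_pos h]

theorem prob_of_internal {v : List (Fin D)} (h : T.Internal v) :
    T.prob p v = ∑ c ∈ T.children v, T.prob p c := by
  rw [AssocTree.prob, dif_neg (T.internal_iff.1 h).2]
  exact Finset.sum_attach (T.children v) (fun c => T.prob p c)

theorem prob_pos (hp : ∀ i, 0 < p i) : ∀ v ∈ T.nodes, 0 < T.prob p v := by
  refine children_induction fun v hv ih => ?_
  rcases T.mem_leaves_or_internal hv with h | h
  · rw [T.prob_of_mem_leaves h]; exact hp _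
  · rw [T.prob_of_internal h]; exact Finset.sum_pos ih h.2

theorem prob_child_le (hp : ∀ i, 0 < p i) {u v : List (Fin D)} (hu : T.Internal u)
    (hv : v ∈ T.children u) : T.prob p v ≤ T.prob p u := by
  rw [T.prob_of_internal hu]
  exact Finset.single_le_sum (f := T.prob p)
    (fun w hw => (T.prob_pos hp w (mem_nodes_of_mem_children hw)).le) hv

theorem prob_le_prob_root (hp : ∀ i, 0 < p i) {v : List (Fin D)} (hv : v ∈ T.nodes) :
    T.prob p v ≤ T.prob p T.root := by
  induction hk : T.level v generalizing v with
  | zero => rw [eq_root_of_level_eq_zero hv hk]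
  | succ k ih =>
    have hne : v ≠ T.root := by
      rintro rfl
      rw [level_root] at hk
      omega
    obtain ⟨u, hu, huv⟩ := exists_parent hv hne
    have := level_child hu.1 huv
    exact (T.prob_child_le hp hu huv).trans (ih hu.1 (by omega))

end AssocTree

/-- If every value on `A` is at most every value on `B`, some of them strictly, and `A` has at most
as many elements as `B`, then the sum over `A` is smaller. -/
theorem sum_lt_sum_of_forall_le {α β : Type*} {A : Finset α} {B : Finset β} {f : α → ℝ} {g : β → ℝ}
    (hg : ∀ b ∈ B, 0 < g b) (hle : ∀ a ∈ A, ∀ b ∈ B, f a ≤ g b) (hc : #A ≤ #B)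
    {a : α} {b : β} (ha : a ∈ A) (hb : b ∈ B) (hab : f a < g b) :
    ∑ a ∈ A, f a < ∑ b ∈ B, g b := by
  obtain ⟨c, hc', hmin⟩ := Finset.exists_min_image B g ⟨b, hb⟩
  have h1 : ∑ a ∈ A, f a ≤ #A * g c := by
    simpa using Finset.sum_le_card_nsmul A f (g c) (fun x hx => hle x hx c hc')
  have h2 : (#A : ℝ) * g c ≤ #B * g c :=
    mul_le_mul_of_nonneg_right (by exact_mod_cast hc) (hg c hc').le
  have h3 : #B * g c ≤ ∑ b ∈ B, g b := by
    simpa using Finset.card_nsmul_le_sum B g (g c) hmin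
  -- The minimum `g c` separates the two sums. The strict gap `f a < g b` lies either below `g c` or
  -- above it.
  by_cases h : f a < g c
  · have : ∑ a ∈ A, f a < ∑ _a ∈ A, g c :=
      Finset.sum_lt_sum (fun x hx => hle x hx c hc') ⟨a, ha, h⟩
    simp only [Finset.sum_const, nsmul_eq_mul] at this
    linarith
  · have : ∑ _b ∈ B, g c < ∑ b ∈ B, g b :=
      Finset.sum_lt_sum hmin ⟨b, hb, by linarith⟩
    simp only [Finset.sum_const, nsmul_eq_mul] at this
    linarith

/-- The internal nodes of `T` are numbered by `τ` in an order in which they can be created by merging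
their children: children of earlier nodes have at most the probabilities of children of later
ones, and all nodes have `D` children but the first, which has `m`. -/
structure MergeOrder {D n : ℕ} (T : AssocTree D n) (p : Fin n → ℝ) (m : ℕ)
    (τ : List (Fin D) → ℕ) : Prop where
  injOn : ∀ u u', T.Internal u → T.Internal u' → τ u = τ u' → u = u'
  le : ∀ u u', T.Internal u → T.Internal u' → τ u < τ u' →
    ∀ v ∈ T.children u, ∀ w ∈ T.children u', T.prob p v ≤ T.prob p w
  exists_zero : ∃ u, T.Internal u ∧ τ u = 0
  card : ∀ u, T.Internal u → #(T.children u) = if τ u = 0 then m else D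

/-! ### The three properties from a merge order -/

namespace MergeOrder

open DTree

variable {D n : ℕ} {T : AssocTree D n} {p : Fin n → ℝ} {m : ℕ} {τ : List (Fin D) → ℕ}

theorem levelProperty (h : MergeOrder T p m τ) (hp : ∀ i, 0 < p i) (hm : m ≤ D) :
    LevelProperty T p := by
  intro v hv w hw hvw
  induction hk : T.level v generalizing v w with
  | zero =>
    rw [eq_root_of_level_eq_zero hv hk]
    exact T.prob_le_prob_root hp hw
  | succ k ih =>
    have hv0 : v ≠ T.root := by rintro rfl; rw [level_root] at hk; omega
    have hw0 : w ≠ T.root := by rintro rfl; rw [level_root] at hvw; omega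
    obtain ⟨u, hu, huv⟩ := exists_parent hv hv0
    obtain ⟨u', hu', huw⟩ := exists_parent hw hw0
    have l1 := level_child hu.1 huv
    have l2 := level_child hu'.1 huw
    by_contra! hlt
    have hpar := ih u hu.1 u' hu'.1 (by omega) (by omega)
    -- A later or equal parent `u` would contradict `prob v < prob w` or the different levels.
    have hτ : τ u < τ u' := by
      rcases lt_trichotomy (τ u) (τ u') with h1 | h1 | h1
      · exact h1
      · have := h.injOn u u' hu hu' h1
        subst this; omega
      · exact absurd (h.le _ _ hu' hu h1 w huw v huv) hlt.not_ge
    rw [T.prob_of_internal hu, T.prob_of_internal hu'] at hpar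
    refine hpar.not_gt (sum_lt_sum_of_forall_le
      (fun b hb => T.prob_pos hp b (mem_nodes_of_mem_children hb)) (h.le u u' hu hu' hτ) ?_
      huv huw hlt)
    -- Only the node numbered `0` can have fewer than `D` children, and `u'` comes after `u`.
    rw [h.card u hu, h.card u' hu', if_neg (show τ u' ≠ 0 by omega)]
    split_ifs <;> omega

theorem maxLevelSiblingProperty (h : MergeOrder T p m τ) (hp : ∀ i, 0 < p i)
    (hm : IsFirstSize D n m) : MaxLevelSiblingProperty T p := by
  have P1 := h.levelProperty hp hm.2.1
  obtain ⟨u₀, hu₀, hτ₀⟩ := h.exists_zero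
  have hc₀ : #(T.children u₀) = m := by rw [h.card u₀ hu₀, if_pos hτ₀]
  have hmin : ∀ v ∈ T.children u₀, ∀ u, T.Internal u → u ≠ u₀ → ∀ w ∈ T.children u,
      T.prob p v ≤ T.prob p w := fun v hv u hu hne w hw =>
    h.le u₀ u hu₀ hu (by
      have : τ u ≠ τ u₀ := fun e => hne (h.injOn _ _ hu hu₀ e)
      omega) v hv w hw
  have hleaf : ∀ w ∈ T.leaves, ∃ u, T.Internal u ∧ w ∈ T.children u := by
    intro w hw
    obtain ⟨hw, hw'⟩ := T.mem_leaves.1 hw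
    refine exists_parent hw ?_
    rintro rfl
    obtain ⟨v, hv⟩ := hu₀.2
    -- A childless root is the only node: following parents up from any other node reaches level 1,
    -- hence a child of the root.
    have hroot : ∀ v ∈ T.nodes, v = T.root := by
      intro v hv
      by_contra hne
      have key : ∀ k v, v ∈ T.nodes → T.level v ≠ k + 1 := by
        intro k
        induction k with
        | zero =>
          intro v hv hk
          obtain ⟨u, hu, huv⟩ := exists_parent hv
            (by rintro rfl; rw [level_root] at hk; omega)
          have := level_child hu.1 huv
          rw [eq_root_of_level_eq_zero hu.1 (by omega), hw'] at huv
          simp at huv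
        | succ k ih =>
          intro v hv hk
          obtain ⟨u, hu, huv⟩ := exists_parent hv
            (by rintro rfl; rw [level_root] at hk; omega)
          have := level_child hu.1 huv
          exact ih u hu.1 (by omega)
      obtain ⟨u, hu, huv⟩ := exists_parent hv hne
      exact key (T.level u) v hv (level_child hu.1 huv)
    exact ne_root_of_mem_children hu₀.1 hv (hroot v (mem_nodes_of_mem_children hv))
  have hcard : ∀ u, T.Internal u → u ≠ u₀ → #(T.children u) = D := fun u hu hne => by
    rw [h.card u hu, if_neg]
    exact fun e => hne (h.injOn _ _ hu hu₀ (e.trans hτ₀.symm))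
  obtain ⟨s₀, hs₀⟩ := hu₀.2
  have ls₀ := level_child hu₀.1 hs₀
  by_cases hmax : T.level u₀ + 1 = T.maxLevel
  · have hlev : ∀ v ∈ T.children u₀, T.level v = T.maxLevel := fun v hv => by
      rw [level_child hu₀.1 hv, hmax]
    refine ⟨m, hm, T.children u₀, T.isSiblingSet_iff.2 ⟨u₀, hu₀, rfl⟩, hc₀, hlev,
      ⟨fun v hv => mem_leaves_of_level_eq_maxLevel (mem_nodes_of_mem_children hv) (hlev v hv),
        fun v hv w hw => ?_⟩, fun S' hS' hne => ?_⟩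
    · obtain ⟨hw, hw'⟩ := mem_sdiff.1 hw
      obtain ⟨u, hu, huw⟩ := hleaf w hw
      exact hmin v hv u hu (by rintro rfl; exact hw' huw) w huw
    · obtain ⟨u, hu, rfl⟩ := T.isSiblingSet_iff.1 hS'
      exact hcard u hu (by rintro rfl; exact hne rfl)
  -- The first merged set is not at the maximum level. Then a deepest sibling set, that of `u`, can
  -- replace it: the merge order and (P1) bound its probabilities from both sides, so all of them
  -- are equal.
  · obtain ⟨x, hx, hxl⟩ := exists_level_eq_maxLevel (T := T.toDTree)
    have hs₀' := level_le_maxLevel (mem_nodes_of_mem_children hs₀)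
    obtain ⟨u, hu, hux⟩ := exists_parent hx (by
      rintro rfl; rw [level_root] at hxl; omega)
    have lx := level_child hu.1 hux
    have hne : u ≠ u₀ := by rintro rfl; omega
    have hlev : ∀ v ∈ T.children u, T.level v = T.maxLevel := fun v hv => by
      rw [level_child hu.1 hv, ← lx, hxl]
    have heq : ∀ v ∈ T.children u, ∀ s ∈ T.children u₀, T.prob p v = T.prob p s := by
      intro v hv s hs
      refine le_antisymm (P1 s (mem_nodes_of_mem_children hs) v (mem_nodes_of_mem_children hv) ?_)
        (hmin s hs u hu hne v hv)
      rw [hlev v hv, level_child hu₀.1 hs]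
      omega
    have hmD : m = D := by
      refine le_antisymm hm.2.1 ?_
      -- With `c` the common probability, (P1) for the parents reads `D * c ≤ m * c`.
      have hle := P1 u₀ hu₀.1 u hu.1 (by omega)
      rw [T.prob_of_internal hu₀, T.prob_of_internal hu,
        Finset.sum_congr rfl (fun v hv => heq v hv s₀ hs₀),
        Finset.sum_congr rfl (fun v hv => (heq x hux v hv).symm.trans (heq x hux s₀ hs₀)),
        Finset.sum_const, Finset.sum_const, hc₀, hcard u hu hne, nsmul_eq_mul, nsmul_eq_mul] at hle
      exact_mod_cast le_of_mul_le_mul_right hle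
        (T.prob_pos hp _ (mem_nodes_of_mem_children hs₀))
    refine ⟨m, hm, T.children u, T.isSiblingSet_iff.2 ⟨u, hu, rfl⟩,
      (hcard u hu hne).trans hmD.symm, hlev,
      ⟨fun v hv => mem_leaves_of_level_eq_maxLevel (mem_nodes_of_mem_children hv) (hlev v hv),
        fun v hv w hw => ?_⟩, fun S' hS' _ => ?_⟩
    · obtain ⟨u', hu', huw⟩ := hleaf w (mem_sdiff.1 hw).1
      by_cases he : u' = u₀
      · subst he
        exact (heq v hv w huw).le
      · exact (heq v hv s₀ hs₀).le.trans (hmin s₀ hs₀ u' hu' he w huw)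
    · obtain ⟨u', hu', rfl⟩ := T.isSiblingSet_iff.1 hS'
      by_cases he : u' = u₀
      · rw [he, hc₀, hmD]
      · exact hcard u' hu' he

theorem siblingProperty (h : MergeOrder T p m τ) : SiblingProperty T p := by
  intro l
  -- The tail of a word is its parent. The tail of `T.root` need not be a node, but the root is
  -- alone at its level.
  let key : List (Fin D) → ℕ ×ₗ ℝ := fun v => toLex (τ v.tail, T.prob p v)
  let N := (T.nodes.filter (fun v => T.level v = l)).toList
  let L := N.insertionSort (fun v w => key v ≤ key w)
  have hperm : L.Perm N := List.perm_insertionSort _ _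
  have hmem : ∀ v, v ∈ L ↔ v ∈ T.nodes ∧ T.level v = l := fun v => by
    rw [hperm.mem_iff, Finset.mem_toList, Finset.mem_filter]
  have hsort : L.Pairwise (fun v w => key v ≤ key w) :=
    haveI : IsTrans (List (Fin D)) (fun v w => key v ≤ key w) := ⟨fun _ _ _ => le_trans⟩
    haveI : Std.Total (fun v w : List (Fin D) => key v ≤ key w) := ⟨fun _ _ => le_total _ _⟩
    List.pairwise_insertionSort _ _
  have hpar : ∀ u v, v ∈ T.children u → v.tail = u := fun u v hv => by
    obtain ⟨-, a, rfl⟩ := T.mem_children.1 hv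
    rfl
  refine ⟨L, hperm.nodup_iff.2 (Finset.nodup_toList _), hmem, ?_, ?_⟩
  · refine hsort.imp_of_mem fun {v w} hv hw hvw => ?_
    obtain ⟨hv, hvl⟩ := (hmem v).1 hv
    obtain ⟨hw, hwl⟩ := (hmem w).1 hw
    by_cases hv0 : v = T.root
    · rw [eq_root_of_level_eq_zero hw (by rw [hwl, ← hvl, hv0, level_root]), hv0]
    have hw0 : w ≠ T.root := fun e =>
      hv0 (eq_root_of_level_eq_zero hv (by rw [hvl, ← hwl, e, level_root]))
    obtain ⟨u, hu, huv⟩ := exists_parent hv hv0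
    obtain ⟨u', hu', huw⟩ := exists_parent hw hw0
    rcases (Prod.Lex.toLex_le_toLex).1 hvw with h1 | h1
    · simp only [hpar u v huv, hpar u' w huw] at h1
      exact h.le u u' hu hu' h1 v huv w huw
    · exact h1.2
  · intro x y z hs hxz
    obtain ⟨u, hu, hux, huz⟩ := hxz
    have hu' := internal_of_mem_children hu hux
    have hpw := hsort.sublist hs
    simp only [List.pairwise_cons, List.mem_cons, List.not_mem_nil, or_false,
      forall_eq_or_imp, forall_eq] at hpw
    obtain ⟨⟨hxy, -⟩, hyz, -⟩ := hpw
    obtain ⟨hy, hyl⟩ := (hmem y).1 (hs.subset (by simp))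
    obtain ⟨hx, hxl⟩ := (hmem x).1 (hs.subset (by simp))
    have hlx := level_child hu hux
    obtain ⟨w, hw, hwy⟩ := exists_parent hy (by rintro rfl; rw [level_root] at hyl; omega)
    -- The parent of `y` is numbered between the parents of `x` and `z`, both equal to `u`;
    -- injectivity of `τ` finishes.
    have e1 : τ u ≤ τ w := by
      rcases (Prod.Lex.toLex_le_toLex).1 hxy with h1 | h1
      · simp only [hpar _ _ hux, hpar _ _ hwy] at h1; exact h1.le
      · simp only [hpar _ _ hux, hpar _ _ hwy] at h1; exact h1.1.le
    have e2 : τ w ≤ τ u := by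
      rcases (Prod.Lex.toLex_le_toLex).1 hyz with h1 | h1
      · simp only [hpar _ _ huz, hpar _ _ hwy] at h1; exact h1.le
      · simp only [hpar _ _ huz, hpar _ _ hwy] at h1; exact h1.1.le
    have := h.injOn u w hu' hw (le_antisymm e1 e2)
    subst this
    exact ⟨u, hu, hux, hwy⟩

end MergeOrder

end HuffmanTree
namespace HuffmanTree

open Finset

/-! ### The invariant of a run and its transport to the tree -/

namespace Forest

variable {n : ℕ}

/-- The children of the vertex `u` of the forest. -/
def children (F : Forest n) (u : Fin n ⊕ ℕ) : Finset (Fin n ⊕ ℕ) :=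
  F.verts.filter (fun v => F.parent v = some u)

theorem mem_roots {F : Forest n} {v : Fin n ⊕ ℕ} :
    v ∈ F.roots ↔ v ∈ F.verts ∧ F.parent v = none := by
  simp [roots]

end Forest

/-- What holds for a forest after `k` merging steps, the first of which merged `m` vertices and the
others `D`, where `τ` numbers the new vertices in the order of their creation. -/
structure ForestInvariant {n : ℕ} (D m : ℕ) (p : Fin n → ℝ) (F : Forest n) (τ : Fin n ⊕ ℕ → ℕ)
    (k : ℕ) : Prop where
  mem_of_parent : ∀ u v, F.parent v = some u → v ∈ F.verts ∧ u ∈ F.verts ∧ τ u < k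
  prob_inl : ∀ i, Sum.inl i ∈ F.verts ∧ F.prob (Sum.inl i) = p i
  prob_eq_sum : ∀ u v, F.parent v = some u → F.prob u = ∑ w ∈ F.children u, F.prob w
  injOn : ∀ u u' v v', F.parent v = some u → F.parent v' = some u' → τ u = τ u' → u = u'
  le : ∀ u u' v v', F.parent v = some u → F.parent v' = some u' → τ u < τ u' →
    F.prob v ≤ F.prob v'
  le_root : ∀ u v, F.parent v = some u → ∀ t ∈ F.roots, F.prob v ≤ F.prob t
  card : ∀ u v, F.parent v = some u → #(F.children u) = if τ u = 0 then m else D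
  exists_zero : 0 < k → ∃ u v, F.parent v = some u ∧ τ u = 0
  pos : ∀ v ∈ F.verts, 0 < F.prob v

namespace ForestInvariant

variable {D m n k : ℕ} {p : Fin n → ℝ} {F F' : Forest n} {τ : Fin n ⊕ ℕ → ℕ}

theorem initial (hp : ∀ i, 0 < p i) : ForestInvariant D m p (Forest.initial p) τ 0 where
  mem_of_parent := by simp [Forest.initial]
  prob_inl := by simp [Forest.initial]
  prob_eq_sum := by simp [Forest.initial]
  injOn := by simp [Forest.initial]
  le := by simp [Forest.initial]
  le_root := by simp [Forest.initial]
  card := by simp [Forest.initial]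
  exists_zero := by simp
  pos := by simp [Forest.initial, hp]

/-- The clause `le_root` carries the induction: earlier merged vertices are at most all roots, in
particular those merged now, while minimality of `S` and positivity of the probabilities restore the
clause for the remaining roots and the new one. The new vertex gets the number `k`, larger than all
numbers of earlier parents. -/
theorem merge (h : ForestInvariant D m p F τ k) {c : ℕ} (hc : c = if k = 0 then m else D)
    (hc0 : 0 < c) (hM : Forest.Merge c F F') : ∃ τ', ForestInvariant D m p F' τ' (k + 1) := by
  obtain ⟨S, r, hS, hSc, hmin, hr, rfl⟩ := hM
  have hSv : ∀ s ∈ S, s ∈ F.verts ∧ F.parent s = none := fun s hs => Forest.mem_roots.1 (hS hs)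
  have hrS : r ∉ S := fun e => hr (hSv r e).1
  have hpar : ∀ u v, (F.addParent S r).parent v = some u ↔
      (v ∈ S ∧ u = r) ∨ (v ∉ S ∧ u ≠ r ∧ F.parent v = some u) := by
    intro u v
    simp only [Forest.addParent]
    split_ifs with hv
    · simp [hv, eq_comm]
    · simp only [hv, false_and, not_false_eq_true, true_and, false_or]
      exact ⟨fun e => ⟨by rintro rfl; exact hr (h.mem_of_parent _ _ e).2.1, e⟩, fun e => e.2⟩
  have hprob : ∀ v ∈ F.verts, (F.addParent S r).prob v = F.prob v := fun v hv =>
    Function.update_of_ne (by rintro rfl; exact hr hv) _ _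
  have hprobr : (F.addParent S r).prob r = ∑ s ∈ S, F.prob s := Function.update_self _ _ _
  have hchr : (F.addParent S r).children r = S := by
    ext v
    rw [Forest.children, Finset.mem_filter, hpar]
    simp only [Forest.addParent, Finset.mem_insert]
    constructor
    · rintro ⟨-, ⟨h1, -⟩ | ⟨-, h1, -⟩⟩
      · exact h1
      · exact absurd rfl h1
    · exact fun hv => ⟨Or.inr (hSv v hv).1, Or.inl ⟨hv, trivial⟩⟩
  have hch : ∀ u, u ≠ r → (F.addParent S r).children u = F.children u := by
    intro u hu
    ext v
    rw [Forest.children, Forest.children, Finset.mem_filter, Finset.mem_filter, hpar]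
    simp only [hu, and_false, false_or, Forest.addParent, Finset.mem_insert]
    constructor
    · rintro ⟨-, -, -, h1⟩
      exact ⟨(h.mem_of_parent _ _ h1).1, h1⟩
    · rintro ⟨h1, h2⟩
      refine ⟨Or.inr h1, fun hv => ?_, hu, h2⟩
      rw [(hSv v hv).2] at h2
      cases h2
  have hτ : ∀ u, u ≠ r → Function.update τ r k u = τ u := fun u hu => Function.update_of_ne hu _ _
  have hτr : Function.update τ r k r = k := Function.update_self _ _ _
  have hSpos : ∀ s ∈ S, 0 < F.prob s := fun s hs => h.pos s (hSv s hs).1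
  have hsingle : ∀ s ∈ S, F.prob s ≤ ∑ s ∈ S, F.prob s := fun s hs =>
    Finset.single_le_sum (f := F.prob) (fun w hw => (hSpos w hw).le) hs
  obtain ⟨s₀, hs₀⟩ : S.Nonempty := Finset.card_pos.1 (by omega)
  refine ⟨Function.update τ r k, ?_, ?_, ?_, ?_, ?_, ?_, ?_, ?_, ?_⟩
  · intro u v huv
    rcases (hpar u v).1 huv with ⟨h1, rfl⟩ | ⟨h1, h2, h3⟩
    · refine ⟨Finset.mem_insert_of_mem (hSv v h1).1, Finset.mem_insert_self _ _, ?_⟩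
      rw [hτr]; omega
    · obtain ⟨a, b, c⟩ := h.mem_of_parent _ _ h3
      refine ⟨Finset.mem_insert_of_mem a, Finset.mem_insert_of_mem b, ?_⟩
      rw [hτ u h2]; omega
  · intro i
    obtain ⟨a, b⟩ := h.prob_inl i
    exact ⟨Finset.mem_insert_of_mem a, by rw [hprob _ a, b]⟩
  · intro u v huv
    rcases (hpar u v).1 huv with ⟨h1, rfl⟩ | ⟨h1, h2, h3⟩
    · rw [hchr, hprobr]
      exact Finset.sum_congr rfl fun s hs => (hprob s (hSv s hs).1).symm
    · rw [hch u h2, hprob u (h.mem_of_parent _ _ h3).2.1, h.prob_eq_sum u v h3]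
      exact Finset.sum_congr rfl fun s hs => (hprob s (Finset.mem_filter.1 hs).1).symm
  · intro u u' v v' huv huv' e
    rcases (hpar u v).1 huv with ⟨h1, rfl⟩ | ⟨h1, h2, h3⟩ <;>
      rcases (hpar u' v').1 huv' with ⟨h1', rfl⟩ | ⟨h1', h2', h3'⟩
    · rfl
    · rw [hτr, hτ _ h2'] at e
      have := (h.mem_of_parent _ _ h3').2.2
      omega
    · rw [hτr, hτ _ h2] at e
      have := (h.mem_of_parent _ _ h3).2.2
      omega
    · rw [hτ _ h2, hτ _ h2'] at e
      exact h.injOn u u' v v' h3 h3' e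
  · intro u u' v v' huv huv' e
    rcases (hpar u v).1 huv with ⟨h1, rfl⟩ | ⟨h1, h2, h3⟩ <;>
      rcases (hpar u' v').1 huv' with ⟨h1', rfl⟩ | ⟨h1', h2', h3'⟩
    · exact absurd e (lt_irrefl _)
    · rw [hτr, hτ _ h2'] at e
      have := (h.mem_of_parent _ _ h3').2.2
      omega
    · rw [hprob v (h.mem_of_parent _ _ h3).1, hprob v' (hSv v' h1').1]
      exact h.le_root u v h3 v' (hS h1')
    · rw [hτ _ h2, hτ _ h2'] at e
      rw [hprob v (h.mem_of_parent _ _ h3).1, hprob v' (h.mem_of_parent _ _ h3').1]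
      exact h.le u u' v v' h3 h3' e
  · intro u v huv t ht
    obtain ⟨ht, htp⟩ := Forest.mem_roots.1 ht
    have htS : t ∉ S := fun e => by simp [Forest.addParent, e] at htp
    have htp' : F.parent t = none := by simpa [Forest.addParent, htS] using htp
    rcases Finset.mem_insert.1 ht with rfl | ht
    · rw [hprobr]
      rcases (hpar u v).1 huv with ⟨h1, rfl⟩ | ⟨h1, h2, h3⟩
      · rw [hprob v (hSv v h1).1]
        exact hsingle v h1
      · rw [hprob v (h.mem_of_parent _ _ h3).1]
        -- The new root is compared with `v` through one of its children.
        exact (h.le_root u v h3 s₀ (hS hs₀)).trans (hsingle s₀ hs₀)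
    · have htr : t ∈ F.roots := Forest.mem_roots.2 ⟨ht, htp'⟩
      rw [hprob t ht]
      rcases (hpar u v).1 huv with ⟨h1, rfl⟩ | ⟨h1, h2, h3⟩
      · rw [hprob v (hSv v h1).1]
        exact hmin v h1 t (Finset.mem_sdiff.2 ⟨htr, htS⟩)
      · rw [hprob v (h.mem_of_parent _ _ h3).1]
        exact h.le_root u v h3 t htr
  · intro u v huv
    rcases (hpar u v).1 huv with ⟨h1, rfl⟩ | ⟨h1, h2, h3⟩
    · rw [hchr, hSc, hτr, hc]
    · rw [hch u h2, hτ u h2, h.card u v h3]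
  · intro _
    rcases Nat.eq_zero_or_pos k with hk | hk
    · exact ⟨r, s₀, (hpar r s₀).2 (Or.inl ⟨hs₀, rfl⟩), hτr.trans hk⟩
    · obtain ⟨u, v, huv, hu⟩ := h.exists_zero hk
      have hur : u ≠ r := by rintro rfl; exact hr (h.mem_of_parent _ _ huv).2.1
      have hvS : v ∉ S := fun e => by rw [(hSv v e).2] at huv; cases huv
      exact ⟨u, v, (hpar u v).2 (Or.inr ⟨hvS, hur, huv⟩), by rw [hτ u hur, hu]⟩
  · intro v hv
    rcases Finset.mem_insert.1 hv with rfl | hv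
    · rw [hprobr]
      exact Finset.sum_pos hSpos ⟨s₀, hs₀⟩
    · rw [hprob v hv]
      exact h.pos v hv

end ForestInvariant

theorem HuffmanForest.exists_forestInvariant {D n : ℕ} (hD : 2 ≤ D) {p : Fin n → ℝ}
    (hp : ∀ i, 0 < p i) {F : Forest n} (hF : HuffmanForest D p F) :
    ∃ m τ k, IsFirstSize D n m ∧ 0 < k ∧ ForestInvariant D m p F τ k := by
  induction hF with
  | @first m F hm h =>
    obtain ⟨τ, hτ⟩ := (ForestInvariant.initial (D := D) (m := m) (τ := fun _ => 0) hp).merge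
      (if_pos rfl).symm (by have := hm.1; omega) h
    exact ⟨m, τ, 1, hm, one_pos, hτ⟩
  | next _ _ h ih =>
    obtain ⟨m, τ, k, hm, hk, hτ⟩ := ih
    obtain ⟨τ', hτ'⟩ := hτ.merge (if_neg hk.ne').symm (by omega) h
    exact ⟨m, τ', k + 1, hm, k.succ_pos, hτ'⟩

-- The isomorphism pulls the numbering back to `T`. Probabilities agree by induction from the
-- leaves, since on both sides a parent has the sum over its children.
open DTree in
theorem IsHuffmanTree.exists_mergeOrder {D n : ℕ} (hD : 2 ≤ D) {p : Fin n → ℝ}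
    (hp : ∀ i, 0 < p i) {T : AssocTree D n} (hT : IsHuffmanTree T p) :
    ∃ m τ, IsFirstSize D n m ∧ MergeOrder T p m τ := by
  obtain ⟨F, hF, -, ψ, hψ, hψl⟩ := hT
  obtain ⟨m, τ, k, hm, hk, h⟩ := hF.exists_forestInvariant hD hp
  -- The default value is irrelevant: `f` is used on nodes only.
  let f : List (Fin D) → Fin n ⊕ ℕ := fun v => if hv : v ∈ T.nodes then (ψ ⟨v, hv⟩).1 else Sum.inr 0
  have hf : ∀ v (hv : v ∈ T.nodes), f v = (ψ ⟨v, hv⟩).1 := fun v hv => dif_pos hv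
  have hinj : ∀ v ∈ T.nodes, ∀ w ∈ T.nodes, f v = f w → v = w := fun v hv w hw e => by
    rw [hf v hv, hf w hw] at e
    exact congrArg Subtype.val (ψ.injective (Subtype.ext e))
  have hsurj : ∀ x ∈ F.verts, ∃ v ∈ T.nodes, f v = x := fun x hx =>
    ⟨(ψ.symm ⟨x, hx⟩).1, (ψ.symm ⟨x, hx⟩).2, by rw [hf _ (ψ.symm ⟨x, hx⟩).2]; simp⟩
  have hmem : ∀ v ∈ T.nodes, f v ∈ F.verts := fun v hv => by rw [hf v hv]; exact (ψ _).2
  have hpar : ∀ v ∈ T.nodes, ∀ w ∈ T.nodes, F.parent (f w) = some (f v) ↔ w ∈ T.children v :=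
    fun v hv w hw => by rw [hf v hv, hf w hw]; exact hψ ⟨v, hv⟩ ⟨w, hw⟩
  have hpar' : ∀ v ∈ T.nodes, ∀ w ∈ T.children v, F.parent (f w) = some (f v) := fun v hv w hw =>
    (hpar v hv w (mem_nodes_of_mem_children hw)).2 hw
  have hch : ∀ v ∈ T.nodes, F.children (f v) = (T.children v).image f := by
    intro v hv
    ext x
    simp only [Forest.children, Finset.mem_filter, Finset.mem_image]
    constructor
    · rintro ⟨hx, hxv⟩
      obtain ⟨w, hw, rfl⟩ := hsurj x hx
      exact ⟨w, (hpar v hv w hw).1 hxv, rfl⟩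
    · rintro ⟨w, hw, rfl⟩
      exact ⟨hmem w (mem_nodes_of_mem_children hw), hpar' v hv w hw⟩
  have hinjc : ∀ v, Set.InjOn f (T.children v) := fun v w hw w' hw' =>
    hinj w (mem_nodes_of_mem_children hw) w' (mem_nodes_of_mem_children hw')
  have hprob : ∀ v ∈ T.nodes, T.prob p v = F.prob (f v) := by
    refine children_induction fun v hv ih => ?_
    rcases T.mem_leaves_or_internal hv with hl | hi
    · rw [T.prob_of_mem_leaves hl, hf v hv, hψl ⟨v, hv⟩ hl, (h.prob_inl _).2]
    · obtain ⟨w, hw⟩ := hi.2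
      rw [T.prob_of_internal hi, h.prob_eq_sum _ _ (hpar' v hv w hw), hch v hv,
        Finset.sum_image (hinjc v)]
      exact Finset.sum_congr rfl ih
  refine ⟨m, fun v => τ (f v), hm, ⟨?_, ?_, ?_, ?_⟩⟩
  · rintro u u' ⟨hu, v, hv⟩ ⟨hu', v', hv'⟩ e
    exact hinj u hu u' hu' (h.injOn _ _ _ _ (hpar' u hu v hv) (hpar' u' hu' v' hv') e)
  · intro u u' hu hu' e v hv w hw
    rw [hprob v (mem_nodes_of_mem_children hv), hprob w (mem_nodes_of_mem_children hw)]
    exact h.le _ _ _ _ (hpar' u hu.1 v hv) (hpar' u' hu'.1 w hw) e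
  · obtain ⟨x, y, hxy, hx⟩ := h.exists_zero hk
    obtain ⟨hy', hx', -⟩ := h.mem_of_parent _ _ hxy
    obtain ⟨u, hu, rfl⟩ := hsurj x hx'
    obtain ⟨v, hv, rfl⟩ := hsurj y hy'
    exact ⟨u, ⟨hu, v, (hpar u hu v hv).1 hxy⟩, hx⟩
  · rintro u ⟨hu, v, hv⟩
    rw [← h.card _ _ (hpar' u hu v hv), hch u hu, Finset.card_image_of_injOn (hinjc u)]

end HuffmanTree
namespace HuffmanTree

open Finset

/-! ### Building a run that produces the tree -/

namespace AssocTree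

open DTree

variable {D n : ℕ} (T : AssocTree D n)

open Classical in
/-- The vertex of the Huffman forest used for a node of `T`: the labelled source symbol for a leaf,
and a new vertex for an internal node. -/
def vertex (v : List (Fin D)) : Fin n ⊕ ℕ :=
  if h : v ∈ T.leaves then Sum.inl (T.label ⟨v, h⟩) else Sum.inr (Encodable.encode v)

theorem vertex_of_mem_leaves {v : List (Fin D)} (h : v ∈ T.leaves) :
    T.vertex v = Sum.inl (T.label ⟨v, h⟩) := dif_pos h

theorem vertex_injective : Function.Injective T.vertex := by
  intro v w e
  unfold vertex at e
  split_ifs at e with hv hw hw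
  · exact congrArg Subtype.val (T.label.injective (Sum.inl_injective e))
  · exact Encodable.encode_injective (Sum.inr_injective e)

end AssocTree

open DTree

variable {D n : ℕ}

/-- `F` is the part of `T` that is obtained from the leaves when the internal nodes in `I` have been
made the parents of their children. -/
structure PartialForest (T : AssocTree D n) (p : Fin n → ℝ) (I : Finset (List (Fin D)))
    (F : Forest n) : Prop where
  internal : ∀ u ∈ I, T.Internal u
  closed : ∀ u ∈ I, ∀ v ∈ T.children u, v ∈ T.leaves ∨ v ∈ I
  mem_verts : ∀ x, x ∈ F.verts ↔ ∃ v, (v ∈ T.leaves ∨ v ∈ I) ∧ T.vertex v = x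
  parent : ∀ w ∈ T.nodes, ∀ x, F.parent (T.vertex w) = some x ↔
    ∃ u ∈ I, w ∈ T.children u ∧ T.vertex u = x
  prob : ∀ v, v ∈ T.leaves ∨ v ∈ I → F.prob (T.vertex v) = T.prob p v

theorem pair_sublist_or_pair_sublist {α : Type*} {l : List α} {a b : α} (ha : a ∈ l) (hb : b ∈ l)
    (hab : a ≠ b) : [a, b].Sublist l ∨ [b, a].Sublist l := by
  obtain ⟨l₁, l₂, rfl⟩ := List.append_of_mem ha
  rcases List.mem_append.1 hb with h | h
  · exact Or.inr ((List.singleton_sublist.2 h).append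
      (List.singleton_sublist.2 List.mem_cons_self))
  · have h := (List.mem_cons.1 h).resolve_left hab.symm
    exact Or.inl (((List.singleton_sublist.2 h).cons_cons a).trans (List.sublist_append_right _ _))

namespace PartialForest

variable {T : AssocTree D n} {p : Fin n → ℝ} {I : Finset (List (Fin D))} {F : Forest n}

theorem initial : PartialForest T p ∅ (Forest.initial p) where
  internal := by simp
  closed := by simp
  mem_verts x := by
    simp only [Forest.initial, Finset.mem_map, Finset.mem_univ, true_and,
      Function.Embedding.inl_apply, Finset.notMem_empty, or_false]
    constructor
    · rintro ⟨i, rfl⟩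
      refine ⟨(T.label.symm i).1, (T.label.symm i).2, ?_⟩
      rw [T.vertex_of_mem_leaves (T.label.symm i).2]
      simp
    · rintro ⟨v, hv, rfl⟩
      exact ⟨_, (T.vertex_of_mem_leaves hv).symm⟩
  parent := by simp [Forest.initial]
  prob v hv := by
    have hv : v ∈ T.leaves := by simpa using hv
    rw [T.vertex_of_mem_leaves hv, T.prob_of_mem_leaves hv]
    rfl

theorem mem_nodes (h : PartialForest T p I F) {v : List (Fin D)} (hv : v ∈ T.leaves ∨ v ∈ I) :
    v ∈ T.nodes :=
  hv.elim (fun hv => (T.mem_leaves.1 hv).1) fun hv => (h.internal v hv).1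

theorem mem_roots (h : PartialForest T p I F) {v : List (Fin D)} :
    T.vertex v ∈ F.roots ↔ (v ∈ T.leaves ∨ v ∈ I) ∧ ∀ u ∈ I, v ∉ T.children u := by
  have h1 : T.vertex v ∈ F.verts ↔ v ∈ T.leaves ∨ v ∈ I := by
    rw [h.mem_verts]
    exact ⟨fun ⟨w, hw, e⟩ => T.vertex_injective e ▸ hw, fun hv => ⟨v, hv, rfl⟩⟩
  rw [Forest.mem_roots, h1]
  refine and_congr_right fun hv => ?_
  rw [Option.eq_none_iff_forall_ne_some]
  constructor
  · exact fun hn u hu huv => hn _ ((h.parent v (h.mem_nodes hv) _).2 ⟨u, hu, huv, rfl⟩)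
  · intro hn x hx
    obtain ⟨u, hu, huv, -⟩ := (h.parent v (h.mem_nodes hv) x).1 hx
    exact hn u hu huv

theorem image_children_subset_roots (h : PartialForest T p I F) {u : List (Fin D)} (hu : u ∉ I)
    (hch : ∀ v ∈ T.children u, v ∈ T.leaves ∨ v ∈ I) :
    (T.children u).image T.vertex ⊆ F.roots := by
  intro x hx
  obtain ⟨v, hv, rfl⟩ := Finset.mem_image.1 hx
  exact h.mem_roots.2 ⟨hch v hv, fun u' hu' hv' => hu (parent_unique hv hv' ▸ hu')⟩

theorem card_image_children (T : AssocTree D n) (u : List (Fin D)) :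
    #((T.children u).image T.vertex) = #(T.children u) :=
  Finset.card_image_of_injective _ T.vertex_injective

/-- One step of the run. The hypothesis `hmin` is the choice rule of the algorithm read in `T`,
where the current roots are the nodes present whose parent is not yet in `I`. -/
theorem exists_merge (h : PartialForest T p I F) {u : List (Fin D)} (hi : T.Internal u)
    (hu : u ∉ I) (hch : ∀ v ∈ T.children u, v ∈ T.leaves ∨ v ∈ I)
    (hmin : ∀ s ∈ T.children u, ∀ t, (t ∈ T.leaves ∨ t ∈ I) → (∀ u' ∈ I, t ∉ T.children u') →
      t ∉ T.children u → T.prob p s ≤ T.prob p t) :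
    ∃ F', Forest.Merge (#(T.children u)) F F' ∧ PartialForest T p (insert u I) F' := by
  have hul : u ∉ T.leaves := (T.internal_iff.1 hi).2
  have hur : T.vertex u ∉ F.verts := by
    rw [h.mem_verts]
    rintro ⟨w, hw, e⟩
    rw [T.vertex_injective e] at hw
    exact hw.elim hul hu
  refine ⟨F.addParent ((T.children u).image T.vertex) (T.vertex u),
    ⟨_, _, h.image_children_subset_roots hu hch, card_image_children T u, ?_, hur, rfl⟩, ?_⟩
  · intro x hx y hy
    obtain ⟨s, hs, rfl⟩ := Finset.mem_image.1 hx
    obtain ⟨hy, hy'⟩ := Finset.mem_sdiff.1 hy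
    obtain ⟨t, -, rfl⟩ := (h.mem_verts y).1 (Forest.mem_roots.1 hy).1
    obtain ⟨ht, ht'⟩ := h.mem_roots.1 hy
    rw [h.prob s (hch s hs), h.prob t ht]
    exact hmin s hs t ht ht' fun e => hy' (Finset.mem_image_of_mem _ e)
  · refine ⟨?_, ?_, ?_, ?_, ?_⟩
    · intro w hw
      rcases Finset.mem_insert.1 hw with rfl | hw
      · exact hi
      · exact h.internal w hw
    · intro w hw v hv
      have : v ∈ T.leaves ∨ v ∈ I := by
        rcases Finset.mem_insert.1 hw with rfl | hw
        · exact hch v hv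
        · exact h.closed w hw v hv
      exact this.imp_right (Finset.mem_insert_of_mem)
    · intro x
      simp only [Forest.addParent, Finset.mem_insert, h.mem_verts]
      constructor
      · rintro (rfl | ⟨v, hv, rfl⟩)
        · exact ⟨u, by simp, rfl⟩
        · exact ⟨v, by tauto, rfl⟩
      · rintro ⟨v, hv | rfl | hv, rfl⟩
        · exact Or.inr ⟨v, Or.inl hv, rfl⟩
        · exact Or.inl rfl
        · exact Or.inr ⟨v, Or.inr hv, rfl⟩
    · intro w hw x
      have hwS : T.vertex w ∈ (T.children u).image T.vertex ↔ w ∈ T.children u := by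
        rw [Finset.mem_image]
        exact ⟨fun ⟨v, hv, e⟩ => T.vertex_injective e ▸ hv, fun hv => ⟨w, hv, rfl⟩⟩
      simp only [Forest.addParent, hwS]
      split_ifs with hwu
      · rw [Option.some_inj]
        constructor
        · exact fun e => ⟨u, Finset.mem_insert_self _ _, hwu, e⟩
        · rintro ⟨u', -, hu', rfl⟩
          rw [parent_unique hwu hu']
      · rw [h.parent w hw]
        constructor
        · rintro ⟨u', hu', h1, h2⟩
          exact ⟨u', Finset.mem_insert_of_mem hu', h1, h2⟩
        · rintro ⟨u', hu', h1, h2⟩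
          rcases Finset.mem_insert.1 hu' with rfl | hu'
          · exact absurd h1 hwu
          · exact ⟨u', hu', h1, h2⟩
    · intro v hv
      by_cases hvu : v = u
      · subst hvu
        rw [T.prob_of_internal hi]
        refine (Function.update_self _ _ _).trans ?_
        rw [Finset.sum_image T.vertex_injective.injOn]
        exact Finset.sum_congr rfl fun s hs => h.prob s (hch s hs)
      · have hv' : v ∈ T.leaves ∨ v ∈ I := by
          simpa [hvu] using hv
        exact (Function.update_of_ne (fun e => hvu (T.vertex_injective e)) _ _).trans (h.prob v hv')

/-- The next internal node to be created: one at the largest possible level whose children come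
first in the list of the sibling property. -/
theorem exists_next (h : PartialForest T p I F) (P1 : LevelProperty T p)
    (P3 : SiblingProperty T p) (hI : ∃ u, T.Internal u ∧ u ∉ I) :
    ∃ u, T.Internal u ∧ u ∉ I ∧ (∀ v ∈ T.children u, v ∈ T.leaves ∨ v ∈ I) ∧
      ∀ s ∈ T.children u, ∀ t, (t ∈ T.leaves ∨ t ∈ I) → (∀ u' ∈ I, t ∉ T.children u') →
        t ∉ T.children u → T.prob p s ≤ T.prob p t := by
  classical
  obtain ⟨u₀, hu₀, hmax⟩ := Finset.exists_max_image
    (T.nodes.filter fun u => T.Internal u ∧ u ∉ I) T.level (by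
      obtain ⟨u, hu, hu'⟩ := hI
      exact ⟨u, Finset.mem_filter.2 ⟨hu.1, hu, hu'⟩⟩)
  obtain ⟨-, hu₀i, hu₀I⟩ := Finset.mem_filter.1 hu₀
  replace hmax : ∀ u, T.Internal u → u ∉ I → T.level u ≤ T.level u₀ := fun u hu hu' =>
    hmax u (Finset.mem_filter.2 ⟨hu.1, hu, hu'⟩)
  obtain ⟨L, -, hmem, hsort, hsib⟩ := P3 (T.level u₀ + 1)
  -- Only children of missing nodes are kept; the parent of the first one, `x`, is the node to
  -- create.
  let q : List (Fin D) → Bool := fun v => decide (∃ u, T.Internal u ∧ u ∉ I ∧ v ∈ T.children u)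
  have hq : ∀ v, q v = true ↔ ∃ u, T.Internal u ∧ u ∉ I ∧ v ∈ T.children u := fun v =>
    decide_eq_true_iff
  have hmem' : ∀ v, v ∈ L.filter q ↔
      ∃ u, T.Internal u ∧ u ∉ I ∧ v ∈ T.children u ∧ T.level u = T.level u₀ := by
    intro v
    rw [List.mem_filter, hmem, hq]
    constructor
    · rintro ⟨⟨-, hl⟩, u, hu, huI, huv⟩
      have := level_child hu.1 huv
      exact ⟨u, hu, huI, huv, by omega⟩
    · rintro ⟨u, hu, huI, huv, hl⟩
      have := level_child hu.1 huv
      exact ⟨⟨mem_nodes_of_mem_children huv, by omega⟩, u, hu, huI, huv⟩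
  obtain ⟨v₀, hv₀⟩ := hu₀i.2
  have hv₀L := (hmem' v₀).2 ⟨u₀, hu₀i, hu₀I, hv₀, rfl⟩
  have hsub : (L.filter q).Sublist L := List.filter_sublist
  rcases hL : L.filter q with _ | ⟨x, L'⟩
  · rw [hL] at hv₀L; cases hv₀L
  rw [hL] at hmem' hsub
  have hsort' := hsort.sublist hsub
  obtain ⟨u, hu, huI, hux, hul⟩ := (hmem' x).1 List.mem_cons_self
  refine ⟨u, hu, huI, fun v hv => ?_, fun s hs t ht htI htu => ?_⟩
  -- A missing internal child would be deeper than the largest level of a missing node.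
  · by_contra! hv'
    have hvi := (T.mem_leaves_or_internal (mem_nodes_of_mem_children hv)).resolve_left hv'.1
    have h1 := hmax v hvi hv'.2
    have h2 := level_child hu.1 hv
    omega
  · have htn := h.mem_nodes ht
    have hsn := mem_nodes_of_mem_children hs
    have hsl := level_child hu.1 hs
    -- Otherwise `t` has a missing parent, which is no deeper than `u`, so `t` and `s` share a level
    -- and both occur in the filtered list.
    by_cases htl : T.level t < T.level s
    · exact P1 t htn s hsn htl
    obtain ⟨u', hu', hut⟩ := exists_parent htn (by rintro rfl; rw [level_root] at htl; omega)
    have hu'I : u' ∉ I := fun e => htI u' e hut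
    have h1 := hmax u' hu' hu'I
    have h2 := level_child hu'.1 hut
    have htL := (hmem' t).2 ⟨u', hu', hu'I, hut, by omega⟩
    have hsL := (hmem' s).2 ⟨u, hu, huI, hs, hul⟩
    have htx : t ≠ x := by rintro rfl; exact htu hux
    have htL' : t ∈ L' := (List.mem_cons.1 htL).resolve_left htx
    rcases List.mem_cons.1 hsL with rfl | hsL'
    · exact (List.pairwise_cons.1 hsort').1 t htL'
    · have hst : s ≠ t := by rintro rfl; exact htu hs
      rcases pair_sublist_or_pair_sublist hsL' htL' hst with hsubl | hsubl
      · exact (List.pairwise_cons.1 hsort').2.forall_sublist hsubl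
      -- Listed between the siblings `x` and `s`, the node `t` would be a child of `u`.
      · obtain ⟨w, hw, hwx, hwt⟩ := hsib x t s ((hsubl.cons_cons x).trans hsub) ⟨u, hu.1, hux, hs⟩
        exact absurd (parent_unique hwx hux ▸ hwt) htu

theorem isTree (h : PartialForest T p I F) (hI : ∀ u, T.Internal u → u ∈ I) : F.IsTree := by
  rw [Forest.IsTree, Finset.card_eq_one]
  refine ⟨T.vertex T.root, ?_⟩
  ext x
  rw [Finset.mem_singleton]
  constructor
  · intro hx
    obtain ⟨v, hv, rfl⟩ := (h.mem_verts x).1 (Forest.mem_roots.1 hx).1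
    obtain ⟨hv, hv'⟩ := h.mem_roots.1 hx
    by_contra hne
    obtain ⟨u, hu, huv⟩ := exists_parent (h.mem_nodes hv) (fun e => hne (congrArg _ e))
    exact hv' u (hI u hu) huv
  · rintro rfl
    exact h.mem_roots.2 ⟨(T.mem_leaves_or_internal T.root_mem).imp_right (hI _),
      fun u hu hr => ne_root_of_mem_children (h.internal u hu).1 hr rfl⟩

theorem isHuffmanTree (h : PartialForest T p I F) (hF : HuffmanForest D p F)
    (hI : ∀ u, T.Internal u → u ∈ I) : IsHuffmanTree T p := by
  have hv : ∀ v, v ∈ T.nodes ↔ v ∈ T.leaves ∨ v ∈ I := fun v =>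
    ⟨fun hv => (T.mem_leaves_or_internal hv).imp_right (hI v), h.mem_nodes⟩
  refine ⟨F, hF, h.isTree hI, Equiv.ofBijective
    (fun v => ⟨T.vertex v.1, (h.mem_verts _).2 ⟨v.1, (hv _).1 v.2, rfl⟩⟩) ⟨?_, ?_⟩, ?_, ?_⟩
  · intro v w e
    exact Subtype.ext (T.vertex_injective (congrArg Subtype.val e))
  · rintro ⟨x, hx⟩
    obtain ⟨v, hv', rfl⟩ := (h.mem_verts x).1 hx
    exact ⟨⟨v, (hv v).2 hv'⟩, rfl⟩
  · intro v w
    change F.parent (T.vertex w.1) = some (T.vertex v.1) ↔ _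
    rw [h.parent w.1 w.2]
    constructor
    · rintro ⟨u, -, hu, e⟩
      rwa [← T.vertex_injective e]
    · exact fun hw => ⟨v.1, hI _ (internal_of_mem_children v.2 hw), hw, rfl⟩
  · exact fun v hv => T.vertex_of_mem_leaves hv

theorem isHuffmanTree_of_properties (hD : 2 ≤ D) (h : PartialForest T p I F)
    (hF : HuffmanForest D p F) (P1 : LevelProperty T p) (P3 : SiblingProperty T p)
    (hcard : ∀ u, T.Internal u → u ∉ I → #(T.children u) = D) : IsHuffmanTree T p := by
  induction hk : #(T.nodes \ I) using Nat.strong_induction_on generalizing I F with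
  | _ k ih =>
    by_cases hI : ∃ u, T.Internal u ∧ u ∉ I
    · obtain ⟨u, hu, huI, hch, hmin⟩ := h.exists_next P1 P3 hI
      obtain ⟨F', hM, h'⟩ := h.exists_merge hu huI hch hmin
      have hc := hcard u hu huI
      -- The run may continue: the `D ≥ 2` children of `u` are distinct roots.
      have hT : ¬ F.IsTree := by
        intro hT
        have := Finset.card_le_card (h.image_children_subset_roots huI hch)
        rw [card_image_children, hc, hT] at this
        omega
      rw [hc] at hM
      refine ih _ ?_ h' (hF.next hT hM)
        (fun w hw hwI => hcard w hw fun e => hwI (Finset.mem_insert_of_mem e)) rfl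
      rw [← hk]
      refine Finset.card_lt_card ⟨Finset.sdiff_subset_sdiff subset_rfl (Finset.subset_insert _ _),
        fun hs => ?_⟩
      have := hs (Finset.mem_sdiff.2 ⟨hu.1, huI⟩)
      simp at this
    · push Not at hI
      exact h.isHuffmanTree hF hI

end PartialForest

theorem isHuffmanTree_of_properties (hD : 2 ≤ D) {T : AssocTree D n} {p : Fin n → ℝ}
    (P1 : LevelProperty T p) (P2 : MaxLevelSiblingProperty T p) (P3 : SiblingProperty T p) :
    IsHuffmanTree T p := by
  obtain ⟨m, hm, S, hS, hc, -, ⟨hSl, hmin⟩, hD'⟩ := P2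
  obtain ⟨u, hu, rfl⟩ := T.isSiblingSet_iff.1 hS
  obtain ⟨F, hM, h⟩ := (PartialForest.initial (T := T) (p := p)).exists_merge hu
    (Finset.notMem_empty u) (fun v hv => Or.inl (hSl hv)) fun s hs t ht _ htu =>
      hmin s hs t (Finset.mem_sdiff.2 ⟨by simpa using ht, htu⟩)
  rw [hc] at hM
  -- Distinct internal nodes have distinct sibling sets, as these are nonempty and parents are
  -- unique; so every node still missing has `D` children.
  refine h.isHuffmanTree_of_properties hD (.first hm hM) P1 P3 fun w hw hwu =>
    hD' _ (T.isSiblingSet_iff.2 ⟨w, hw, rfl⟩) fun e => hwu ?_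
  obtain ⟨v, hv⟩ := hw.2
  rw [parent_unique hv (e ▸ hv)]
  simp

end HuffmanTree

theorem mainTheorem3 (D n : ℕ) (hD : 2 ≤ D) (hn : 2 ≤ n) (p : Fin n → ℝ)
    (hp : p ∈ HuffmanTree.PosPMF n) (T : HuffmanTree.AssocTree D n) :
    HuffmanTree.IsHuffmanTree T p ↔
      HuffmanTree.LevelProperty T p ∧
      HuffmanTree.MaxLevelSiblingProperty T p ∧
      HuffmanTree.SiblingProperty T p := by
  constructor
  · intro hT
    obtain ⟨m, τ, hm, h⟩ := hT.exists_mergeOrder hD hp.1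
    exact ⟨h.levelProperty hp.1 hm.2.1, h.maxLevelSiblingProperty hp.1 hm, h.siblingProperty⟩
  · rintro ⟨P1, P2, P3⟩
    exact HuffmanTree.isHuffmanTree_of_properties hD P1 P2 P3
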